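/- For integers $N,k\ge 0$ let $$\zeta_N(\{1\}_k)=\sum_{N\ge n_1>\cdots>n_k\ge 1}\frac{1}{n_1\cdots n_k},$$ with $\zeta_N(\{1\}_0)=1$. Then for all integers $\ell_2\ge 0$ and $r_1,r_2\ge 1$ the series $$S(0,\ell_2,r_1,r_2)=\sum_{n\ge 1}\frac{\zeta_{n-1}(\{1\}_{\ell_2})}{\binom{n+r_1}{r_1}\,n^{r_2}}$$ converges, and its value is a polynomial with rational coefficients in the single zeta values $\zeta(i)=\sum_{n\ge1}n^{-i}$, $i\ge 2$; that is, $S(0,\ell_2,r_1,r_2)\in\mathbb{Q}[\zeta(2),\zeta(3),\zeta(4),\dots]$. -/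

import Mathlib

noncomputable section

/-- The truncated multiple zeta value
`ζ_N(i₁, …, i_k) = ∑_{N ≥ n₁ > ⋯ > n_k ≥ 1} 1 / (n₁^{i₁} ⋯ n_k^{i_k})`,
written as an iterated sum over `n₁`, then `n₂ ≤ n₁ - 1`, and so on.
The empty index has value `1`. -/
def truncZeta : List ℕ → ℕ → ℝ
  | [], _ => 1
  | i :: is, N => ∑ n ∈ Finset.Icc 1 N, 1 / (n : ℝ) ^ i * truncZeta is (n - 1)

/-- The truncated multiple zeta star value
`ζ*_N(i₁, …, i_k) = ∑_{N ≥ n₁ ≥ ⋯ ≥ n_k ≥ 1} 1 / (n₁^{i₁} ⋯ n_k^{i_k})`,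
written as an iterated sum over `n₁`, then `n₂ ≤ n₁`, and so on.
The empty index has value `1`. -/
def truncZetaStar : List ℕ → ℕ → ℝ
  | [], _ => 1
  | i :: is, N => ∑ n ∈ Finset.Icc 1 N, 1 / (n : ℝ) ^ i * truncZetaStar is n

/-- The `n`-th summand (`n ≥ 1`) of the series `S(ℓ₁, ℓ₂, r₁, r₂)`:
`ζ*_{n-1}({1}_{ℓ₁}) ζ_{n-1}({1}_{ℓ₂}) / (binom(n + r₁, r₁) n^{r₂})`. -/
def seriesTerm (ℓ₁ ℓ₂ r₁ r₂ n : ℕ) : ℝ :=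
  truncZetaStar (List.replicate ℓ₁ 1) (n - 1) * truncZeta (List.replicate ℓ₂ 1) (n - 1) /
    (((n + r₁).choose r₁ : ℝ) * (n : ℝ) ^ r₂)

/-- The series `S(ℓ₁, ℓ₂, r₁, r₂)`, the sum of `seriesTerm ℓ₁ ℓ₂ r₁ r₂ n` over all `n ≥ 1`. -/
def seriesS (ℓ₁ ℓ₂ r₁ r₂ : ℕ) : ℝ :=
  ∑' k : ℕ, seriesTerm ℓ₁ ℓ₂ r₁ r₂ (k + 1)

end

/-!
The binomial factor is removed first. For `n ≥ 1` one has
`1 / (binom(n+r, r) n^{s+1}) = 1 / (binom(n+r-1, r-1) n^{s+1}) - (1/r) / (binom(n+r, r) n^s)`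
(`seriesTerm_succ_succ`), so that every series in question is a rational combination of the series
with `r₂ = 1`, `r₁ ≥ 1` and of the series with `r₁ = 0`, `r₂ ≥ 2`. The former telescope by
summation by parts, with value `1 / r₁^{ℓ+1}` (`hasSum_seriesTerm_one`). The latter are the
height-one multiple zeta values `ζ(r₂, {1}_ℓ)`.

For these, set `P_n = ∏_{m ≤ n} (1 + x/m)` and `Q_n = ∏_{m ≤ n} (1 - x/m)`; the coefficient of `x^ℓ`
in `P_n` is `ζ_n({1}_ℓ)`. Expansion into partial fractions in `y`
(`prod_one_sub_eq_one_sub_sum`) gives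
`∏_{n ≤ N} (n - x - y) / (n - y) = 1 - x ∑_{n ≤ N} P_{n-1} Q_{N-n} / (n - y)`,
a finite form of Gauss's summation of `₂F₁` at `1`. It is divided by `Q_N` and read as an identity
of power series in `x` and `y`. As `N → ∞`, the coefficients on the right converge, by dominated
convergence, to `-ζ(a + 2, {1}_b)` (`exists_hasSum_heightOne`); the left side becomes
`G_N = ∏_{n ≤ N} n (n - x - y) / ((n - x) (n - y))`. The logarithmic derivative of `G_N` in `y` is
`∑_{n ≤ N} (1 / (n - y) - 1 / (n - x - y))`, whose coefficients are rational multiples of power sums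
`∑_{n ≤ N} n^{-i}` with `i ≥ 2`. Hence the coefficients of `G_N` are polynomials in these power
sums, with rational coefficients independent of `N`, and converge to elements of `ℚ[ζ(2), ζ(3), …]`
(`coeff_gaussProd_mem_zetaLimits`).
-/

open PowerSeries Filter Topology
open Finset.HasAntidiagonal (antidiagonal mem_antidiagonal)

/-! ### Geometric power series -/

/-- The geometric power series `1 / (1 - r X)`. -/
noncomputable def geomSeries {A : Type*} [CommRing A] (r : A) : A⟦X⟧ :=
  PowerSeries.mk fun k => r ^ k

theorem coeff_geomSeries {A : Type*} [CommRing A] (r : A) (k : ℕ) :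
    coeff k (geomSeries r) = r ^ k := by
  simp [geomSeries]

theorem geomSeries_mul_one_sub {A : Type*} [CommRing A] (r : A) :
    geomSeries r * (1 - C r * X) = 1 := by
  ext n
  rw [mul_sub, mul_one, mul_left_comm, map_sub, coeff_C_mul]
  cases n with
  | zero => simp [coeff_geomSeries]
  | succ n => rw [coeff_succ_mul_X]; simp [coeff_geomSeries, coeff_one, pow_succ']

theorem geomSeries_zero {A : Type*} [CommRing A] : geomSeries (0 : A) = 1 := by
  simpa using geomSeries_mul_one_sub (0 : A)

theorem derivative_mul {A : Type*} [CommRing A] (f g : A⟦X⟧) :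
    d⁄dX A (f * g) = f * d⁄dX A g + g * d⁄dX A f := by
  simp

theorem derivative_C_mul_one_sub_C_mul {A : Type*} [CommRing A] (u x : A) (f : A⟦X⟧) :
    d⁄dX A (C u * (1 - C x * f)) = -(C u * C x * d⁄dX A f) := by
  simp
  ring

theorem derivative_C_mul_geomSeries {A : Type*} [CommRing A] (r : A) :
    d⁄dX A (C r * geomSeries r) = (C r * geomSeries r) ^ 2 := by
  have h := geomSeries_mul_one_sub r
  have hd := congrArg (d⁄dX A) h
  simp only [Derivation.leibniz, map_sub, derivative_C, derivative_X, derivative_one,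
    smul_eq_mul] at hd ⊢
  linear_combination (C r * geomSeries r) * hd - C r * d⁄dX A (geomSeries r) * h

theorem coeff_geomSeries_pow (r : ℝ) (k i : ℕ) :
    coeff i (geomSeries r ^ (k + 1)) = ((k + i).choose k : ℝ) * r ^ i := by
  have h : geomSeries r = rescale r (PowerSeries.mk 1) := by
    ext n; simp [coeff_geomSeries, coeff_rescale]
  rw [h, ← map_pow, mk_one_pow_eq_mk_choose_add, coeff_rescale, coeff_mk, mul_comm]

/-! ### A partial fraction identity -/

/-- The partial fraction expansion of `∏_{n=1}^{N+1} (n - y - x) / (n - y)` in the variable `y`;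
`q j` and `v j` stand for `1 / (j + 1)` and `1 / (j + 1 - y)`. The elements `x`, `y` and `v` vary in
the induction, because the step also uses the identity at `-x` and `y = 0`. -/
theorem prod_one_sub_eq_one_sub_sum {B : Type*} [CommRing B] (q : ℕ → B)
    (hq : ∀ n : ℕ, ((n : B) + 1) * q n = 1) (N : ℕ) :
    ∀ (x y : B) (v : ℕ → B), (∀ n : ℕ, ((n : B) + 1 - y) * v n = 1) →
    ∏ j ∈ Finset.range (N + 1), (1 - x * v j) =
      1 - x * ∑ p ∈ antidiagonal N,
        (∏ j ∈ Finset.range p.1, (1 + x * q j)) *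
        (∏ j ∈ Finset.range p.2, (1 - x * q j)) * v p.1 := by
  induction N with
  | zero => intro x y v _; simp
  | succ N ih =>
    intro x y v hv
    have h1 := ih x y v hv
    have h2 := ih (-x) 0 q (by simpa using hq)
    simp only [neg_mul, sub_neg_eq_add, ← sub_eq_add_neg] at h2
    rw [← Finset.Nat.sum_antidiagonal_swap] at h2
    simp only [Prod.fst_swap, Prod.snd_swap] at h2
    rw [Finset.prod_range_succ, h1, Finset.Nat.sum_antidiagonal_succ']
    simp only [Finset.range_zero, Finset.prod_empty]
    set P : ℕ → B := fun n => ∏ j ∈ Finset.range n, (1 + x * q j) with hP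
    set Q : ℕ → B := fun n => ∏ j ∈ Finset.range n, (1 - x * q j) with hQ
    have hQs : ∀ n, Q (n + 1) = Q n * (1 - x * q n) := fun n => Finset.prod_range_succ _ _
    change (1 - x * ∑ p ∈ antidiagonal N, P p.1 * Q p.2 * v p.1) *
        (1 - x * v (N + 1)) =
      1 - x * (P (N + 1) * 1 * v (N + 1) +
        ∑ p ∈ antidiagonal N, P p.1 * Q (p.2 + 1) * v p.1)
    -- the identity at `-x` and `y = 0`, where the roles of `P` and `Q` are exchanged
    have h2' : P (N + 1) = 1 + x * ∑ p ∈ antidiagonal N, P p.1 * Q p.2 * q p.2 := by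
      refine h2.trans ?_
      congr 2
      exact Finset.sum_congr rfl fun p _ => by ring
    -- `1 / ((j + 1) (i + 1 - y))` splits with common denominator `N + 2 - y` when `i + j = N`
    have key : ∀ p ∈ antidiagonal N,
        q p.2 * v p.1 = v (N + 1) * (q p.2 + v p.1) := by
      intro p hp
      rw [mem_antidiagonal] at hp
      have e1 := hv p.1
      have e2 := hq p.2
      have e3 := hv (N + 1)
      have e4 : ((N + 1 : ℕ) : B) = p.1 + p.2 + 1 := by rw [← hp]; push_cast; ring
      rw [e4] at e3
      linear_combination (-q p.2 * v p.1) * e3 + (v (N + 1) * q p.2) * e1 +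
        (v (N + 1) * v p.1) * e2
    have hsum : ∑ p ∈ antidiagonal N, P p.1 * Q (p.2 + 1) * v p.1 =
        (1 - x * v (N + 1)) * ∑ p ∈ antidiagonal N, P p.1 * Q p.2 * v p.1
          - x * v (N + 1) * ∑ p ∈ antidiagonal N, P p.1 * Q p.2 * q p.2 := by
      rw [Finset.mul_sum, Finset.mul_sum, ← Finset.sum_sub_distrib]
      refine Finset.sum_congr rfl fun p hp => ?_
      rw [hQs]
      linear_combination (-x * P p.1 * Q p.2) * key p hp
    rw [hsum, h2']
    ring

/-! ### Polynomials in zeta values and sequences converging to them -/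

/-- The `ℚ`-subalgebra `ℚ[ζ(2), ζ(3), …]` of the real numbers. -/
noncomputable def zetaAlgebra : Subalgebra ℚ ℝ :=
  Algebra.adjoin ℚ (Set.range fun i : {i : ℕ // 2 ≤ i} => ∑' n : ℕ, 1 / (n : ℝ) ^ (i : ℕ))

theorem exists_aeval_riemannZeta {z : ℝ} (hz : z ∈ zetaAlgebra) :
    ∃ p : MvPolynomial {i : ℕ // 2 ≤ i} ℚ,
      (z : ℂ) = MvPolynomial.aeval
        (fun i : {i : ℕ // 2 ≤ i} => riemannZeta ((i : ℕ) : ℂ)) p := by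
  rw [zetaAlgebra, Algebra.adjoin_range_eq_range_aeval] at hz
  obtain ⟨p, rfl⟩ := hz
  refine ⟨p, ?_⟩
  have h := MvPolynomial.comp_aeval_apply (R := ℚ)
    (f := fun i : {i : ℕ // 2 ≤ i} => ∑' n : ℕ, 1 / (n : ℝ) ^ (i : ℕ))
    (Complex.ofRealAm.restrictScalars ℚ) p
  simp only [AlgHom.coe_restrictScalars', Complex.ofRealAm_coe] at h
  refine h.trans ?_
  congr 2
  funext i
  rw [zeta_nat_eq_tsum_of_gt_one (by have := i.2; omega)]
  push_cast
  rfl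

/-- The `ℚ`-algebra of real sequences that converge to an element of `ℚ[ζ(2), ζ(3), …]`. -/
noncomputable def zetaLimits : Subalgebra ℚ (ℕ → ℝ) where
  carrier := {f | ∃ z ∈ zetaAlgebra, Tendsto f atTop (𝓝 z)}
  mul_mem' := by
    rintro f g ⟨a, ha, hf⟩ ⟨b, hb, hg⟩
    exact ⟨a * b, mul_mem ha hb, hf.mul hg⟩
  add_mem' := by
    rintro f g ⟨a, ha, hf⟩ ⟨b, hb, hg⟩
    exact ⟨a + b, add_mem ha hb, hf.add hg⟩
  algebraMap_mem' r := ⟨_, zetaAlgebra.algebraMap_mem r, tendsto_const_nhds⟩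

theorem mem_zetaLimits {f : ℕ → ℝ} :
    f ∈ zetaLimits ↔ ∃ z ∈ zetaAlgebra, Tendsto f atTop (𝓝 z) := Iff.rfl

theorem sum_pow_mem_zetaLimits {k : ℕ} (hk : 2 ≤ k) :
    (fun N => ∑ j ∈ Finset.range N, (1 / ((j : ℝ) + 1)) ^ k) ∈ zetaLimits := by
  refine ⟨_, Algebra.subset_adjoin ⟨⟨k, hk⟩, rfl⟩, ?_⟩
  have hs : Summable fun n : ℕ => 1 / (n : ℝ) ^ k := Real.summable_one_div_nat_pow.2 hk
  have h := ((summable_nat_add_iff 1).2 hs).hasSum.tendsto_sum_nat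
  change Tendsto _ _ (𝓝 (∑' n : ℕ, 1 / (n : ℝ) ^ k))
  rw [hs.tsum_eq_zero_add]
  simpa [zero_pow (by omega : k ≠ 0)] using h

/-! ### The generating product and its logarithmic derivative -/

/-- The factor `(1 - (x + Y) z) / ((1 - x z) (1 - Y z))`, with `z = q`, of the generating product,
as a power series in `Y` whose coefficients are power series in `x`. -/
noncomputable def gaussFactor (q : ℝ) : ℝ⟦X⟧⟦X⟧ :=
  C (geomSeries q) * (1 - C X * (C (C q) * geomSeries (C q)))

/-- The logarithmic derivative `1 / (n - Y) - 1 / (n - x - Y)`, with `n = 1 / q`, of `gaussFactor q`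
with respect to `Y`. -/
noncomputable def gaussLogDeriv (q : ℝ) : ℝ⟦X⟧⟦X⟧ :=
  C (C q) * geomSeries (C q) - C (C q * geomSeries q) * geomSeries (C q * geomSeries q)

theorem derivative_gaussFactor (q : ℝ) :
    d⁄dX ℝ⟦X⟧ (gaussFactor q) = gaussFactor q * gaussLogDeriv q := by
  have hu : C (geomSeries q) * (1 - C (C q) * C X) = (1 : ℝ⟦X⟧⟦X⟧) := by
    rw [← map_mul, ← map_one C, ← map_sub, ← map_mul, geomSeries_mul_one_sub]
  have hv := geomSeries_mul_one_sub (C q : ℝ⟦X⟧)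
  have hw := geomSeries_mul_one_sub (C q * geomSeries q : ℝ⟦X⟧)
  have hd := derivative_C_mul_geomSeries (C q : ℝ⟦X⟧)
  have hd' : d⁄dX ℝ⟦X⟧ (gaussFactor q) =
      - (C (geomSeries q) * C X * (C (C q) * geomSeries (C q)) ^ 2) := by
    rw [gaussFactor, derivative_C_mul_one_sub_C_mul, hd]
  rw [hd', gaussFactor, gaussLogDeriv]
  rw [map_mul] at hw ⊢
  generalize geomSeries (C q * geomSeries q) = w at *
  generalize geomSeries (C q : ℝ⟦X⟧) = v at *
  generalize C (geomSeries q) = u at *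
  generalize (C X : ℝ⟦X⟧⟦X⟧) = x at *
  generalize (C (C q) : ℝ⟦X⟧⟦X⟧) = z at *
  -- `(1 - x z v) s = z v` for `s = z u w`
  have hs : (1 - x * (z * v)) * (z * u * w) = z * v := by
    have e1 : z * u * w * (1 - z * x - z * X) = z := by
      linear_combination z * hw + z * w * hu
    linear_combination v * e1 + (-(z * u * w)) * hv
  linear_combination u * hs

theorem constantCoeff_gaussFactor (q : ℝ) : coeff 0 (gaussFactor q) = 1 := by
  have := geomSeries_mul_one_sub q
  simp only [coeff_zero_eq_constantCoeff, gaussFactor, map_mul, map_sub, constantCoeff_C, map_one]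
  rw [← coeff_zero_eq_constantCoeff_apply, coeff_geomSeries, pow_zero, mul_one, mul_comm X]
  exact this

theorem coeff_coeff_gaussLogDeriv (q : ℝ) (k i : ℕ) :
    coeff i (coeff k (gaussLogDeriv q)) =
      if i = 0 then 0 else -((k + i).choose k : ℝ) * q ^ (k + i + 1) := by
  rw [gaussLogDeriv, map_sub, coeff_C_mul, coeff_C_mul, coeff_geomSeries, coeff_geomSeries,
    ← pow_succ', ← pow_succ', mul_pow, ← map_pow, map_sub, coeff_C_mul, coeff_geomSeries_pow,
    coeff_C]
  split_ifs with h
  · subst h; simp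
  · ring

/-- The product `∏_{n=1}^N n (n - x - Y) / ((n - x) (n - Y))`. -/
noncomputable def gaussProd (N : ℕ) : ℝ⟦X⟧⟦X⟧ := ∏ j ∈ Finset.range N, gaussFactor (1 / (j + 1))

theorem derivative_gaussProd (N : ℕ) :
    d⁄dX ℝ⟦X⟧ (gaussProd N) =
      gaussProd N * ∑ j ∈ Finset.range N, gaussLogDeriv (1 / (j + 1)) := by
  induction N with
  | zero => simp [gaussProd]
  | succ N ih =>
    rw [gaussProd] at ih ⊢
    rw [Finset.prod_range_succ, derivative_mul, ih, derivative_gaussFactor,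
      Finset.sum_range_succ]
    ring

theorem coeff_gaussLogDeriv_sum_mem_zetaLimits (k i : ℕ) :
    (fun N => coeff i (coeff k (∑ j ∈ Finset.range N, gaussLogDeriv (1 / (j + 1))))) ∈
      zetaLimits := by
  simp only [map_sum, coeff_coeff_gaussLogDeriv]
  by_cases h : i = 0
  · simp only [h, if_true, Finset.sum_const_zero]
    exact zero_mem zetaLimits
  · simp only [h, if_false, ← Finset.mul_sum]
    have := zetaLimits.smul_mem
      (sum_pow_mem_zetaLimits (k := k + i + 1) (by omega)) (-((k + i).choose k : ℚ))
    convert this using 1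
    funext N
    simp [Rat.smul_def]

/-- The logarithmic derivative gives a recursion in the exponent of `Y` which expresses the
coefficients of `gaussProd N` through power sums, with rational coefficients independent of `N`. -/
theorem coeff_gaussProd_mem_zetaLimits (a : ℕ) :
    ∀ b, (fun N => coeff b (coeff a (gaussProd N))) ∈ zetaLimits := by
  induction a using Nat.strong_induction_on with
  | _ a ih =>
    intro b
    cases a with
    | zero =>
      have h : ∀ N, coeff 0 (gaussProd N) = 1 := by
        intro N
        have := constantCoeff_gaussFactor
        simp only [coeff_zero_eq_constantCoeff] at this ⊢
        simp [gaussProd, map_prod, this]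
      simp only [h, coeff_one]
      split_ifs
      · exact one_mem zetaLimits
      · exact zero_mem zetaLimits
    | succ a =>
      have h : (fun N => coeff b (coeff (a + 1) (gaussProd N))) =
          ((a + 1 : ℚ)⁻¹) • ∑ p ∈ antidiagonal a, ∑ r ∈ antidiagonal b,
            (fun N => coeff r.1 (coeff p.1 (gaussProd N))) *
            (fun N => coeff r.2 (coeff p.2
              (∑ j ∈ Finset.range N, gaussLogDeriv (1 / (j + 1))))) := by
        funext N
        have e := congrArg (fun f => coeff b (coeff a f)) (derivative_gaussProd N)
        simp only [coeff_derivative] at e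
        have e' : coeff b (coeff (a + 1) (gaussProd N) * ((a : ℝ⟦X⟧) + 1)) =
            coeff b (coeff (a + 1) (gaussProd N)) * ((a : ℝ) + 1) := by
          have : ((a : ℝ⟦X⟧) + 1) = C ((a : ℝ) + 1) := by simp
          rw [this, coeff_mul_C]
        rw [e', coeff_mul, map_sum] at e
        simp only [coeff_mul (R := ℝ)] at e
        simp only [Pi.smul_apply, Finset.sum_apply, Pi.mul_apply]
        rw [← e, Rat.smul_def]
        push_cast
        field_simp
      rw [h]
      refine zetaLimits.smul_mem (sum_mem fun p hp => sum_mem fun r _ => mul_mem ?_ ?_) _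
      · exact ih p.1 (by have := mem_antidiagonal.1 hp; omega) _
      · exact coeff_gaussLogDeriv_sum_mem_zetaLimits _ _

/-! ### Elementary symmetric functions of `1, 1/2, …, 1/N` -/

/-- The generating function `∏_{n=1}^N (1 + x / n)` of the truncated zeta values
`ζ_N({1}_ℓ)`. -/
noncomputable def onesSeries (N : ℕ) : ℝ⟦X⟧ :=
  ∏ j ∈ Finset.range N, (1 + X * C (1 / ((j : ℝ) + 1)))

theorem truncZeta_ones_succ (l N : ℕ) :
    truncZeta (List.replicate (l + 1) 1) (N + 1) = truncZeta (List.replicate (l + 1) 1) N +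
      1 / ((N : ℝ) + 1) * truncZeta (List.replicate l 1) N := by
  simp only [List.replicate_succ, truncZeta]
  rw [Finset.sum_Icc_succ_top (by omega)]
  simp

theorem truncZeta_ones_zero (l : ℕ) :
    truncZeta (List.replicate l 1) 0 = if l = 0 then 1 else 0 := by
  cases l <;> simp [truncZeta, List.replicate_succ]

theorem coeff_onesSeries (N : ℕ) :
    ∀ l, coeff l (onesSeries N) = truncZeta (List.replicate l 1) N := by
  induction N with
  | zero => intro l; simp [onesSeries, truncZeta_ones_zero, coeff_one]
  | succ N ih =>
    intro l
    have h : onesSeries (N + 1) = onesSeries N + C (1 / ((N : ℝ) + 1)) * (onesSeries N * X) := by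
      rw [onesSeries, Finset.prod_range_succ, ← onesSeries]; ring
    rw [h, map_add, coeff_C_mul, ih]
    cases l with
    | zero => simp [truncZeta]
    | succ l => rw [coeff_succ_mul_X, ih, truncZeta_ones_succ]

/-! ### Bounds for coefficients -/

/-- The coefficients of `f` are nonnegative, and `f` converges at `1/8` to a value at most `M`. -/
def EvalBound (f : ℝ⟦X⟧) (M : ℝ) : Prop :=
  (∀ i, 0 ≤ coeff i f) ∧ Summable (fun i => coeff i f * (1 / 8) ^ i) ∧
    ∑' i, coeff i f * (1 / 8) ^ i ≤ M

namespace EvalBound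

theorem nonneg {f : ℝ⟦X⟧} {M : ℝ} (h : EvalBound f M) : 0 ≤ M :=
  le_trans (tsum_nonneg fun i => mul_nonneg (h.1 i) (by positivity)) h.2.2

theorem mono {f : ℝ⟦X⟧} {M M' : ℝ} (h : EvalBound f M) (hM : M ≤ M') : EvalBound f M' :=
  ⟨h.1, h.2.1, h.2.2.trans hM⟩

theorem coeff_le {f : ℝ⟦X⟧} {M : ℝ} (h : EvalBound f M) (i : ℕ) : coeff i f ≤ 8 ^ i * M := by
  have h1 := (h.2.1.le_tsum i fun j _ => mul_nonneg (h.1 j) (by positivity)).trans h.2.2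
  rw [one_div, inv_pow, ← div_eq_mul_inv, div_le_iff₀ (by positivity)] at h1
  linarith

theorem mul {f g : ℝ⟦X⟧} {M M' : ℝ} (hf : EvalBound f M) (hg : EvalBound g M') :
    EvalBound (f * g) (M * M') := by
  have hnf : ∀ i, 0 ≤ coeff i f * (1 / 8) ^ i := fun i => mul_nonneg (hf.1 i) (by positivity)
  have hng : ∀ i, 0 ≤ coeff i g * (1 / 8) ^ i := fun i => mul_nonneg (hg.1 i) (by positivity)
  have hc : (fun n => coeff n (f * g) * (1 / 8) ^ n) = fun n : ℕ =>
      ∑ p ∈ antidiagonal n,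
        (coeff p.1 f * (1 / 8) ^ p.1) * (coeff p.2 g * (1 / 8) ^ p.2) := by
    funext n
    rw [coeff_mul, Finset.sum_mul]
    refine Finset.sum_congr rfl fun p hp => ?_
    rw [← mem_antidiagonal.1 hp, pow_add]
    ring
  refine ⟨fun i => ?_, ?_, ?_⟩
  · rw [coeff_mul]
    exact Finset.sum_nonneg fun p _ => mul_nonneg (hf.1 _) (hg.1 _)
  · rw [hc]
    exact (summable_norm_sum_mul_antidiagonal_of_summable_norm hf.2.1.norm hg.2.1.norm).of_norm
  · rw [hc, ← tsum_mul_tsum_eq_tsum_sum_antidiagonal_of_summable_norm hf.2.1.norm hg.2.1.norm]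
    exact mul_le_mul hf.2.2 hg.2.2 (tsum_nonneg hng) hf.nonneg

theorem one_add_X_mul_C {z : ℝ} (hz : 0 ≤ z) : EvalBound (1 + X * C z) (1 + z / 8) := by
  have hc : ∀ i, coeff i (1 + X * C z) = if i = 0 then 1 else if i = 1 then z else 0 := by
    intro i
    rw [map_add, coeff_mul_C, coeff_one, coeff_X]
    rcases i with _ | _ | i <;> simp
  have h0 : ∀ i ∉ Finset.range 2, coeff i (1 + X * C z) * (1 / 8) ^ i = 0 := by
    intro i hi
    rw [Finset.mem_range] at hi
    rw [hc, if_neg (by omega), if_neg (by omega), zero_mul]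
  refine ⟨fun i => ?_, summable_of_ne_finset_zero h0, ?_⟩
  · rw [hc]; split_ifs <;> simp [hz]
  · rw [tsum_eq_sum h0, Finset.sum_range_succ, Finset.sum_range_one, hc, hc]
    simp
    linarith

theorem geomSeries {z : ℝ} (hz : 0 ≤ z) (hz' : z ≤ 1) :
    EvalBound (geomSeries z) (1 - z / 8)⁻¹ := by
  have h : HasSum (fun i => coeff i (_root_.geomSeries z) * (1 / 8) ^ i) (1 - z / 8)⁻¹ := by
    have := hasSum_geometric_of_lt_one (r := z / 8) (by positivity) (by linarith)
    convert this using 2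
    rw [coeff_geomSeries, ← mul_pow]
    congr 1
    ring
  exact ⟨fun i => by rw [coeff_geomSeries]; positivity, h.summable, h.tsum_eq.le⟩

theorem prod {f : ℕ → ℝ⟦X⟧} {M : ℕ → ℝ} (n : ℕ) (h : ∀ j, EvalBound (f j) (M j)) :
    EvalBound (∏ j ∈ Finset.range n, f j) (∏ j ∈ Finset.range n, M j) := by
  induction n with
  | zero => simpa using one_add_X_mul_C le_rfl
  | succ n ih =>
    rw [Finset.prod_range_succ, Finset.prod_range_succ]
    exact ih.mul (h n)

end EvalBound

/-- The growth rate `√n` makes the bound summable against `n⁻²`; the evaluation point `1/8` is small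
enough for it. -/
theorem prod_le_sqrt (n : ℕ) :
    ∏ j ∈ Finset.range n, (1 + 1 / ((j : ℝ) + 1) / 8) * (1 - 1 / ((j : ℝ) + 1) / 8)⁻¹ ≤
      √((n : ℝ) + 1) := by
  induction n with
  | zero => simp
  | succ n ih =>
    have hn : (0 : ℝ) ≤ n := n.cast_nonneg
    have hpos : 0 < 8 * (n : ℝ) + 7 := by positivity
    have he : (1 + 1 / ((n : ℝ) + 1) / 8) * (1 - 1 / ((n : ℝ) + 1) / 8)⁻¹ =
        (8 * n + 9) / (8 * n + 7) := by
      have h1 : 1 + 1 / ((n : ℝ) + 1) / 8 = (8 * n + 9) / (8 * (n + 1)) := by field_simp; ring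
      have h2 : 1 - 1 / ((n : ℝ) + 1) / 8 = (8 * n + 7) / (8 * (n + 1)) := by field_simp; ring
      rw [h1, h2]
      field_simp
    rw [Finset.prod_range_succ, he]
    refine (mul_le_mul_of_nonneg_right ih (by positivity)).trans ?_
    rw [mul_div_assoc', div_le_iff₀ hpos]
    apply le_of_sq_le_sq _ (by positivity)
    rw [mul_pow, mul_pow, Real.sq_sqrt (by positivity), Real.sq_sqrt (by positivity)]
    push_cast
    nlinarith [sq_nonneg (n : ℝ)]

theorem evalBound_onesSeries (n : ℕ) : EvalBound (onesSeries n) √((n : ℝ) + 1) := by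
  refine (EvalBound.prod n fun j =>
    EvalBound.one_add_X_mul_C (z := 1 / ((j : ℝ) + 1)) (by positivity)).mono
    (le_trans (Finset.prod_le_prod (fun j _ => by positivity) fun j _ => ?_) (prod_le_sqrt n))
  have h : (1 : ℝ) / ((j : ℝ) + 1) ≤ 1 := by
    rw [div_le_one (by positivity)]; linarith [(j.cast_nonneg : (0 : ℝ) ≤ j)]
  have h0 : (0 : ℝ) ≤ 1 / ((j : ℝ) + 1) := by positivity
  exact le_mul_of_one_le_right (by positivity) ((one_le_inv₀ (by linarith)).2 (by linarith))

theorem truncZeta_ones_nonneg (l N : ℕ) : 0 ≤ truncZeta (List.replicate l 1) N := by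
  rw [← coeff_onesSeries]
  exact (evalBound_onesSeries N).1 l

theorem truncZeta_ones_le (l N : ℕ) :
    truncZeta (List.replicate l 1) N ≤ 8 ^ l * √((N : ℝ) + 1) := by
  rw [← coeff_onesSeries]
  exact (evalBound_onesSeries N).coeff_le l

/-- The product `∏ (1 - x / n)⁻¹` over the `i + 1` integers `n` with `N - i < n ≤ N + 1`. -/
noncomputable def tailSeries (N i : ℕ) : ℝ⟦X⟧ :=
  ∏ t ∈ Finset.range (i + 1), geomSeries (1 / (((N - i + t : ℕ) : ℝ) + 1))

/-- The bound does not depend on `N`: the `t`-th factor of the tail is dominated, coefficient by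
coefficient, by `(1 - x / (t + 1))⁻¹`. -/
theorem evalBound_onesSeries_mul_tailSeries (N i : ℕ) :
    EvalBound (onesSeries i * tailSeries N i) √((i : ℝ) + 2) := by
  have h1 : EvalBound (onesSeries i) (∏ j ∈ Finset.range (i + 1), (1 + 1 / ((j : ℝ) + 1) / 8)) := by
    refine (EvalBound.prod i fun j =>
      EvalBound.one_add_X_mul_C (z := 1 / ((j : ℝ) + 1)) (by positivity)).mono ?_
    rw [Finset.prod_range_succ]
    exact le_mul_of_one_le_right (by positivity) (by
      have : (0 : ℝ) ≤ 1 / ((i : ℝ) + 1) / 8 := by positivity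
      linarith)
  have h2 : EvalBound (tailSeries N i)
      (∏ j ∈ Finset.range (i + 1), (1 - 1 / ((j : ℝ) + 1) / 8)⁻¹) := by
    refine EvalBound.prod (i + 1) fun t => ?_
    have ht : (1 : ℝ) / ((t : ℝ) + 1) ≤ 1 := by
      rw [div_le_one (by positivity)]; linarith [(t.cast_nonneg : (0 : ℝ) ≤ t)]
    have hle : 1 / (((N - i + t : ℕ) : ℝ) + 1) ≤ 1 / ((t : ℝ) + 1) := by
      apply one_div_le_one_div_of_le (by positivity)
      push_cast
      linarith [((N - i).cast_nonneg : (0 : ℝ) ≤ (N - i : ℕ))]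
    refine (EvalBound.geomSeries (by positivity) (hle.trans ht)).mono ?_
    exact inv_anti₀ (by linarith) (by linarith)
  refine (h1.mul h2).mono ?_
  rw [← Finset.prod_mul_distrib]
  refine (prod_le_sqrt (i + 1)).trans_eq ?_
  push_cast
  ring_nf

/-! ### The height-one zeta values `ζ(a + 2, {1}_b)` -/

/-- The coefficients of `gaussProd (N + 1)`, from `prod_one_sub_eq_one_sub_sum` divided by
`∏_{n=1}^{N+1} (1 - x / n)`. -/
theorem coeff_coeff_gaussProd_succ (N a b : ℕ) :
    coeff (b + 1) (coeff (a + 1) (gaussProd (N + 1))) =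
      -∑ i ∈ Finset.range (N + 1), coeff b (onesSeries i * tailSeries N i) *
        (1 / ((i : ℝ) + 1)) ^ (a + 2) := by
  set q : ℕ → ℝ := fun j => 1 / ((j : ℝ) + 1) with hq
  have hq1 : ∀ n : ℕ, ((n : ℝ) + 1) * q n = 1 := fun n => mul_one_div_cancel (by positivity)
  have hC : ∀ n : ℕ, ((n : ℝ⟦X⟧⟦X⟧) + 1) * C (C (q n)) = 1 := by
    intro n
    have : ((n : ℝ⟦X⟧⟦X⟧) + 1) = C (C ((n : ℝ) + 1)) := by simp
    rw [this, ← map_mul, ← map_mul, hq1, map_one, map_one]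
  have hv : ∀ n : ℕ, ((n : ℝ⟦X⟧⟦X⟧) + 1 - X) * (C (C (q n)) * geomSeries (C (q n))) = 1 := by
    intro n
    have h := geomSeries_mul_one_sub (C (q n) : ℝ⟦X⟧)
    linear_combination h + geomSeries (C (q n)) * hC n
  have hid := prod_one_sub_eq_one_sub_sum (fun n => C (C (q n))) hC N (C X) X _ hv
  have hG : gaussProd (N + 1) = C (∏ j ∈ Finset.range (N + 1), geomSeries (q j)) *
      ∏ j ∈ Finset.range (N + 1), (1 - C X * (C (C (q j)) * geomSeries (C (q j)))) := by
    rw [map_prod, ← Finset.prod_mul_distrib]; rfl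
  have hP : ∀ n, ∏ j ∈ Finset.range n, (1 + C X * C (C (q j))) = C (onesSeries n) := by
    intro n
    simp only [onesSeries, map_prod, map_add, map_mul, map_one, hq]
  have hQ : ∀ n, ∏ j ∈ Finset.range n, (1 - C X * C (C (q j))) =
      C (∏ j ∈ Finset.range n, (1 - X * C (q j))) := by
    intro n
    simp only [map_prod, map_sub, map_mul, map_one]
  -- the first `N - i` factors of the denominator cancel
  have hT : ∀ i ∈ Finset.range (N + 1), (∏ j ∈ Finset.range (N + 1), geomSeries (q j)) *
      ∏ j ∈ Finset.range (N - i), (1 - X * C (q j)) = tailSeries N i := by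
    intro i hi
    have hi' : N + 1 = (N - i) + (i + 1) := by have := Finset.mem_range.1 hi; omega
    rw [hi', Finset.prod_range_add, mul_right_comm, ← Finset.prod_mul_distrib,
      Finset.prod_eq_one, one_mul]
    · rfl
    · intro j _
      rw [mul_comm X]
      exact geomSeries_mul_one_sub _
  rw [hG, hid, coeff_C_mul, map_sub, coeff_one, if_neg (by omega), zero_sub, coeff_C_mul,
    Finset.Nat.sum_antidiagonal_eq_sum_range_succ_mk]
  simp only [hP, hQ]
  rw [map_sum, mul_neg, mul_left_comm, Finset.mul_sum, map_neg, mul_comm X, coeff_succ_mul_X,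
    map_sum]
  congr 1
  refine Finset.sum_congr rfl fun i hi => ?_
  rw [← map_mul, coeff_C_mul, coeff_C_mul, coeff_geomSeries, ← pow_succ', ← map_pow,
    ← coeff_mul_C, ← hT i hi]
  congr 1
  ring

theorem tendsto_coeff_tailSeries (i b : ℕ) :
    Tendsto (fun N => coeff b (onesSeries i * tailSeries N i)) atTop
      (𝓝 (truncZeta (List.replicate b 1) i)) := by
  open scoped PowerSeries.WithPiTopology in
  have h : Tendsto (fun N => onesSeries i * tailSeries N i) atTop (𝓝 (onesSeries i * 1)) := by
    refine Tendsto.mul tendsto_const_nhds ?_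
    have h1 : ∏ t ∈ Finset.range (i + 1), (1 : ℝ⟦X⟧) = 1 := by simp
    rw [← h1]
    refine tendsto_finsetProd _ fun t _ => ?_
    rw [← geomSeries_zero, PowerSeries.WithPiTopology.tendsto_iff_coeff_tendsto]
    intro k
    simp only [coeff_geomSeries]
    refine Tendsto.pow ?_ k
    refine (tendsto_one_div_add_atTop_nhds_zero_nat (𝕜 := ℝ)).comp ?_
    exact tendsto_atTop_mono (fun N => Nat.le_add_right _ t) (tendsto_sub_atTop_nat i)
  have h2 := (PowerSeries.WithPiTopology.tendsto_iff_coeff_tendsto _ _ _ _).1 h b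
  rwa [mul_one, coeff_onesSeries] at h2

theorem summable_sqrt_mul_pow (a : ℕ) :
    Summable fun i : ℕ => √((i : ℝ) + 2) * (1 / ((i : ℝ) + 1)) ^ (a + 2) := by
  have h : Summable fun i : ℕ => 2 * (1 / ((i + 1 : ℕ) : ℝ) ^ (3 / 2 : ℝ)) :=
    ((summable_nat_add_iff 1).2
      (Real.summable_one_div_nat_rpow.2 (by norm_num : (1 : ℝ) < 3 / 2))).mul_left 2
  refine Summable.of_nonneg_of_le (fun i => by positivity) (fun i => ?_) h
  have hi : (0 : ℝ) ≤ i := i.cast_nonneg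
  have hx : (0 : ℝ) < (i : ℝ) + 1 := by positivity
  have h1 : √((i : ℝ) + 2) ≤ 2 * √((i : ℝ) + 1) := by
    rw [Real.sqrt_le_left (by positivity), mul_pow, Real.sq_sqrt hx.le]
    linarith
  have h2 : (1 / ((i : ℝ) + 1)) ^ (a + 2) ≤ (1 / ((i : ℝ) + 1)) ^ 2 :=
    pow_le_pow_of_le_one (by positivity) (by rw [div_le_one hx]; linarith) (by omega)
  have h3 : ((i : ℝ) + 1) ^ (3 / 2 : ℝ) * √((i : ℝ) + 1) = ((i : ℝ) + 1) ^ 2 := by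
    rw [Real.sqrt_eq_rpow, ← Real.rpow_add hx]
    norm_num
  calc √((i : ℝ) + 2) * (1 / ((i : ℝ) + 1)) ^ (a + 2)
      ≤ 2 * √((i : ℝ) + 1) * (1 / ((i : ℝ) + 1)) ^ 2 := by gcongr
    _ = 2 * (1 / ((i + 1 : ℕ) : ℝ) ^ (3 / 2 : ℝ)) := by
      have hs : 0 < √((i : ℝ) + 1) := Real.sqrt_pos.2 hx
      have hr : 0 < ((i : ℝ) + 1) ^ (3 / 2 : ℝ) := by positivity
      push_cast
      rw [one_div_pow, ← h3]
      field_simp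

/-- The height-one multiple zeta value `ζ(a + 2, {1}_b)` is minus the limit of the coefficient of
`x ^ (b + 1) * Y ^ (a + 1)` in `gaussProd N`, hence a polynomial in single zeta values. -/
theorem exists_hasSum_heightOne (a b : ℕ) :
    ∃ z ∈ zetaAlgebra, HasSum (fun i : ℕ => truncZeta (List.replicate b 1) i *
      (1 / ((i : ℝ) + 1)) ^ (a + 2)) z := by
  have hsum := (summable_sqrt_mul_pow a).mul_left (8 ^ b)
  have hs : Summable (fun i : ℕ => truncZeta (List.replicate b 1) i *
      (1 / ((i : ℝ) + 1)) ^ (a + 2)) := by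
    refine Summable.of_nonneg_of_le
      (fun i => mul_nonneg (truncZeta_ones_nonneg b i) (by positivity)) (fun i => ?_) hsum
    rw [← mul_assoc]
    refine mul_le_mul_of_nonneg_right ((truncZeta_ones_le b i).trans ?_) (by positivity)
    gcongr
    norm_num
  have hlim := tendsto_tsum_of_dominated_convergence (𝓕 := atTop)
    (f := fun N i => if i ∈ Finset.range (N + 1) then
      coeff b (onesSeries i * tailSeries N i) * (1 / ((i : ℝ) + 1)) ^ (a + 2) else 0)
    (g := fun i => truncZeta (List.replicate b 1) i * (1 / ((i : ℝ) + 1)) ^ (a + 2))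
    hsum (fun i => by
      refine ((tendsto_coeff_tailSeries i b).mul_const _).congr' ?_
      filter_upwards [eventually_ge_atTop i] with N hN
      rw [if_pos (Finset.mem_range.2 (by omega))])
    (Eventually.of_forall fun N i => by
      have h := evalBound_onesSeries_mul_tailSeries N i
      split_ifs
      · rw [Real.norm_of_nonneg (mul_nonneg (h.1 b) (by positivity)), ← mul_assoc]
        exact mul_le_mul_of_nonneg_right (h.coeff_le b) (by positivity)
      · rw [norm_zero]; positivity)
  obtain ⟨z, hz, hzlim⟩ := mem_zetaLimits.1 (coeff_gaussProd_mem_zetaLimits (a + 1) (b + 1))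
  have hz' := ((tendsto_add_atTop_iff_nat 1).2 hzlim).neg
  refine ⟨-z, neg_mem hz, ?_⟩
  rw [← tendsto_nhds_unique hlim (hz'.congr fun N => ?_)]
  · exact hs.hasSum
  · rw [coeff_coeff_gaussProd_succ, neg_neg, tsum_eq_sum (s := Finset.range (N + 1))]
    · exact Finset.sum_congr rfl fun i hi => (if_pos hi).symm
    · exact fun i hi => if_neg hi

/-! ### Reduction of the binomial factor -/

theorem seriesTerm_eq (l r s k : ℕ) :
    seriesTerm 0 l r s (k + 1) = truncZeta (List.replicate l 1) k /
      (((k + 1 + r).choose r : ℝ) * ((k : ℝ) + 1) ^ s) := by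
  simp [seriesTerm, truncZetaStar]

theorem cast_choose_succ (k r : ℕ) :
    ((k + (r + 1)).choose (r + 1) : ℝ) * (r + 1) = (k + r + 1) * ((k + r).choose r : ℝ) := by
  exact_mod_cast (Nat.add_one_mul_choose_eq (k + r) r).symm

theorem cast_choose_add_pos (n r : ℕ) : (0 : ℝ) < ((n + r).choose r : ℝ) := by
  exact_mod_cast Nat.choose_pos (Nat.le_add_left r n)

theorem seriesTerm_succ_succ (l r s k : ℕ) :
    seriesTerm 0 l (r + 1) (s + 1) (k + 1) = seriesTerm 0 l r (s + 1) (k + 1) -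
      (1 / ((r : ℝ) + 1)) * seriesTerm 0 l (r + 1) s (k + 1) := by
  simp only [seriesTerm_eq]
  have h := cast_choose_succ (k + 1) r
  have h1 := cast_choose_add_pos (k + 1) r
  have h2 := cast_choose_add_pos (k + 1) (r + 1)
  generalize ((k + 1 + (r + 1)).choose (r + 1) : ℝ) = c at *
  generalize ((k + 1 + r).choose r : ℝ) = d at *
  have hk : (0 : ℝ) < (k : ℝ) + 1 := by positivity
  have hr : (0 : ℝ) < (r : ℝ) + 1 := by positivity
  push_cast at h
  field_simp
  linear_combination (-truncZeta (List.replicate l 1) k * ((k : ℝ) + 1) ^ s) * h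

theorem one_div_choose_sub (r k : ℕ) :
    1 / ((k + (r + 1)).choose (r + 1) : ℝ) - 1 / ((k + 1 + (r + 1)).choose (r + 1) : ℝ) =
      (r + 1) * (1 / (((k + 1 + (r + 1)).choose (r + 1) : ℝ) * (k + 1))) := by
  have h : ((k + (r + 1)).choose (r + 1) : ℝ) * (k + r + 2) =
      ((k + 1 + (r + 1)).choose (r + 1) : ℝ) * (k + 1) := by
    have := Nat.choose_mul_succ_eq (k + (r + 1)) (r + 1)
    rw [show k + (r + 1) + 1 - (r + 1) = k + 1 by omega,
      show k + (r + 1) + 1 = k + 1 + (r + 1) by ring] at this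
    have h' := congrArg (Nat.cast (R := ℝ)) this
    push_cast at h'
    linear_combination h'
  have h1 := cast_choose_add_pos k (r + 1)
  have h2 := cast_choose_add_pos (k + 1) (r + 1)
  generalize ((k + 1 + (r + 1)).choose (r + 1) : ℝ) = c at *
  generalize ((k + (r + 1)).choose (r + 1) : ℝ) = d at *
  have hk : (0 : ℝ) < (k : ℝ) + 1 := by positivity
  field_simp
  linear_combination -h

theorem sum_seriesTerm_zero_one (r K : ℕ) :
    (r + 1) * ∑ k ∈ Finset.range K, seriesTerm 0 0 (r + 1) 1 (k + 1) =
      1 - truncZeta (List.replicate 0 1) K * (1 / ((K + (r + 1)).choose (r + 1) : ℝ)) := by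
  induction K with
  | zero => simp [truncZeta]
  | succ K ih =>
    rw [Finset.sum_range_succ, mul_add, ih, seriesTerm_eq]
    have h := one_div_choose_sub r K
    simp only [List.replicate_zero, truncZeta, pow_one]
    linear_combination -h

/-- Summation by parts, with `truncZeta_ones_succ` and `one_div_choose_sub`. -/
theorem sum_seriesTerm_succ_one (l r K : ℕ) :
    (r + 1) * ∑ k ∈ Finset.range K, seriesTerm 0 (l + 1) (r + 1) 1 (k + 1) =
      ∑ k ∈ Finset.range K, seriesTerm 0 l (r + 1) 1 (k + 1) -
      truncZeta (List.replicate (l + 1) 1) K * (1 / ((K + (r + 1)).choose (r + 1) : ℝ)) := by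
  induction K with
  | zero => simp [truncZeta_ones_zero]
  | succ K ih =>
    rw [Finset.sum_range_succ, Finset.sum_range_succ, mul_add, ih, seriesTerm_eq, seriesTerm_eq,
      truncZeta_ones_succ, pow_one]
    have h := one_div_choose_sub r K
    rw [div_eq_mul_one_div (truncZeta (List.replicate (l + 1) 1) K),
      div_eq_mul_one_div (truncZeta (List.replicate l 1) K)]
    simp only [← one_div_mul_one_div] at h ⊢
    linear_combination (-truncZeta (List.replicate (l + 1) 1) K) * h

theorem add_one_le_choose (K r : ℕ) : K + 1 ≤ (K + (r + 1)).choose (r + 1) := by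
  induction r with
  | zero => simp
  | succ r ih =>
    rw [← add_assoc K, Nat.choose_succ_succ]
    exact ih.trans (Nat.le_add_right _ _)

theorem tendsto_truncZeta_ones_div_choose (l r : ℕ) :
    Tendsto (fun K : ℕ => truncZeta (List.replicate l 1) K *
      (1 / ((K + (r + 1)).choose (r + 1) : ℝ))) atTop (𝓝 0) := by
  have h0 : Tendsto (fun K : ℕ => 8 ^ l * (1 / √((K : ℝ) + 1))) atTop (𝓝 0) := by
    rw [← mul_zero ((8 : ℝ) ^ l)]
    refine Tendsto.const_mul _ ?_
    simp only [one_div]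
    exact (Real.tendsto_sqrt_atTop.comp
      (tendsto_atTop_add_const_right _ _ tendsto_natCast_atTop_atTop)).inv_tendsto_atTop
  refine squeeze_zero (fun K => mul_nonneg (truncZeta_ones_nonneg l K) (by positivity))
    (fun K => ?_) h0
  have hK : (0 : ℝ) < (K : ℝ) + 1 := by positivity
  have hc : (K : ℝ) + 1 ≤ ((K + (r + 1)).choose (r + 1) : ℝ) := by
    exact_mod_cast add_one_le_choose K r
  calc _ ≤ 8 ^ l * √((K : ℝ) + 1) * (1 / ((K : ℝ) + 1)) :=
        mul_le_mul (truncZeta_ones_le l K) (one_div_le_one_div_of_le hK hc) (by positivity)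
          (by positivity)
    _ = 8 ^ l * (1 / √((K : ℝ) + 1)) := by
      have hs := Real.sq_sqrt hK.le
      have hp := Real.sqrt_pos.2 hK
      field_simp
      exact hs

theorem seriesTerm_nonneg (l r s k : ℕ) : 0 ≤ seriesTerm 0 l r s (k + 1) := by
  rw [seriesTerm_eq]
  exact div_nonneg (truncZeta_ones_nonneg l k) (by positivity)

theorem hasSum_seriesTerm_one (l r : ℕ) :
    HasSum (fun k => seriesTerm 0 l (r + 1) 1 (k + 1)) ((1 / ((r : ℝ) + 1)) ^ (l + 1)) := by
  rw [hasSum_iff_tendsto_nat_of_nonneg fun k => seriesTerm_nonneg l (r + 1) 1 k]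
  have hr : (0 : ℝ) < (r : ℝ) + 1 := by positivity
  induction l with
  | zero =>
    have h := (((tendsto_truncZeta_ones_div_choose 0 r).const_sub 1).const_mul (1 / ((r : ℝ) + 1)))
    rw [sub_zero, mul_one] at h
    rw [zero_add, pow_one]
    refine h.congr fun K => ?_
    rw [← sum_seriesTerm_zero_one]
    field_simp
  | succ l ih =>
    have h := (ih.sub (tendsto_truncZeta_ones_div_choose (l + 1) r)).const_mul (1 / ((r : ℝ) + 1))
    rw [sub_zero, ← pow_succ'] at h
    refine h.congr fun K => ?_
    rw [← sum_seriesTerm_succ_one]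
    field_simp

theorem exists_hasSum_seriesTerm_zero (l s : ℕ) :
    ∃ z ∈ zetaAlgebra, HasSum (fun k => seriesTerm 0 l 0 (s + 2) (k + 1)) z := by
  obtain ⟨z, hz, h⟩ := exists_hasSum_heightOne s l
  refine ⟨z, hz, ?_⟩
  convert h using 2 with k
  simp [seriesTerm_eq, div_eq_mul_inv]

theorem exists_hasSum_seriesTerm (l s : ℕ) :
    ∀ r, ∃ z ∈ zetaAlgebra, HasSum (fun k => seriesTerm 0 l (r + 1) (s + 1) (k + 1)) z := by
  induction s with
  | zero =>
    intro r
    refine ⟨_, pow_mem ?_ _, hasSum_seriesTerm_one l r⟩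
    have := zetaAlgebra.algebraMap_mem (1 / ((r : ℚ) + 1))
    simpa using this
  | succ s ihs =>
    -- the step of both inductions: `binom(n + r + 1, r + 1)` is traded for `binom(n + r, r)`
    have step : ∀ r z, z ∈ zetaAlgebra →
        HasSum (fun k => seriesTerm 0 l r (s + 2) (k + 1)) z →
        ∃ z ∈ zetaAlgebra, HasSum (fun k => seriesTerm 0 l (r + 1) (s + 2) (k + 1)) z := by
      intro r z hz h
      obtain ⟨w, hw, h'⟩ := ihs r
      refine ⟨z - 1 / ((r : ℝ) + 1) * w, sub_mem hz (mul_mem ?_ hw), ?_⟩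
      · have := zetaAlgebra.algebraMap_mem (1 / ((r : ℚ) + 1))
        simpa using this
      · simp only [seriesTerm_succ_succ l r (s + 1)]
        exact h.sub (h'.mul_left _)
    intro r
    induction r with
    | zero =>
      obtain ⟨z, hz, h⟩ := exists_hasSum_seriesTerm_zero l s
      exact step 0 z hz h
    | succ r ihr =>
      obtain ⟨z, hz, h⟩ := ihr
      exact step (r + 1) z hz h

theorem mainTheorem4 (ℓ₂ r₁ r₂ : ℕ) (hr₁ : 1 ≤ r₁) (hr₂ : 1 ≤ r₂) :
    Summable (fun k : ℕ => seriesTerm 0 ℓ₂ r₁ r₂ (k + 1)) ∧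
      ∃ p : MvPolynomial {i : ℕ // 2 ≤ i} ℚ,
        (seriesS 0 ℓ₂ r₁ r₂ : ℂ) =
          MvPolynomial.aeval (fun i : {i : ℕ // 2 ≤ i} => riemannZeta ((i : ℕ) : ℂ)) p := by
  obtain ⟨r, rfl⟩ := Nat.exists_eq_add_of_le' hr₁
  obtain ⟨s, rfl⟩ := Nat.exists_eq_add_of_le' hr₂
  obtain ⟨z, hz, h⟩ := exists_hasSum_seriesTerm ℓ₂ s r
  refine ⟨h.summable, ?_⟩
  rw [seriesS, h.tsum_eq]
  exact exists_aeval_riemannZeta hz
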